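/- Let $C, A_1,\dots,A_m \in \mathbb{R}^{n\times n}$ be symmetric, $b\in\mathbb{R}^m$, $\beta>0$, and let $\mathcal{P}_1$ be the set of $X\in\mathbb{R}^{n\times n}$ with $X\succeq 0$ and $\mathrm{Tr}\,X=1$. Assume that the constraints $\mathrm{Tr}[A_iX]=b_i$ $(i=1,\dots,m)$ are satisfied by at least one $X\in\mathcal{P}_1$. Write $S(X)=\mathrm{Tr}[X\log X]$ (with $0\log 0=0$) and, for $\lambda\in\mathbb{R}^m$, $\lambda\cdot A=\sum_i\lambda_iA_i$, and let $$f_\beta(\lambda)=-\min_{X\in\mathcal{P}_1}\Big\{\mathrm{Tr}[CX]+\beta^{-1}S(X)-\sum_{i=1}^m\lambda_i\big(\mathrm{Tr}[A_iX]-b_i\big)\Big\}$$ be the negative dual objective of the entropically regularized semidefinite program of minimizing $\mathrm{Tr}[CX]+\beta^{-1}S(X)$ over $X\in\mathcal{P}_1$ subject to $\mathrm{Tr}[A_iX]=b_i$ for all $i$. Let $\|\cdot\|$ be a norm on $\mathbb{R}^m$ with $\|\lambda\cdot A\|_2\le\|\lambda\|$ for all $\lambda$, where $\|\cdot\|_2$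 is the spectral norm, and let $\|x\|_*=\sup_{\|y\|\le1}x\cdot y$ be its dual norm. Let $\gamma\ge0$ and let $T\ge1$ be an integer. Suppose that $\lambda_0=0$ and that, for $t=0,\dots,T-1$, $$\lambda_{t+1}\in\operatorname*{argmin}_{\lambda\in\mathbb{R}^m}\Big\{f_\beta(\lambda_t)+g_t\cdot(\lambda-\lambda_t)+\frac{1}{2\eta}\|\lambda-\lambda_t\|^2\Big\},\qquad \eta=\frac1\beta,$$ where the gradient estimates $g_t\in\mathbb{R}^m$ satisfy $\|g_t-\nabla f_\beta(\lambda_t)\|_*\le\gamma$. Then $f_\beta$ is differentiable on $\mathbb{R}^m$, and there exists $t\in\{0,\dots,T-1\}$ such that $$\|\nabla f_\beta(\lambda_t)\|_*\le 3\gamma+2\sqrt{\frac{\beta\,\Delta e(C)}{T}}+2\sqrt{\frac{\log n}{T}},$$ where $\Delta e(C)$ is the difference between the largest and the smallest eigenvalue of $C$. -/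

import Mathlib

noncomputable section

namespace EntropicSDP

/-- The set of density matrices: real positive semidefinite (in particular symmetric) matrices of
trace one. -/
def densityMatrices (n : ℕ) : Set (Matrix (Fin n) (Fin n) ℝ) :=
  {X | X.PosSemidef ∧ X.trace = 1}

/-- The von Neumann entropy `Tr[X log X]` of a density matrix, with the convention
`0 log 0 = 0`; the matrix function is given by the continuous functional calculus, that is, it is
applied to the eigenvalues of `X`. -/
def entropy {n : ℕ} (X : Matrix (Fin n) (Fin n) ℝ) : ℝ :=
  (cfc (fun x : ℝ => x * Real.log x) X).trace

/-- The matrix `lam · A = ∑ i, lam i • A i`. -/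
def dotMat {n m : ℕ} (lam : EuclideanSpace ℝ (Fin m))
    (A : Fin m → Matrix (Fin n) (Fin n) ℝ) : Matrix (Fin n) (Fin n) ℝ :=
  ∑ i, lam i • A i

/-- The spectral norm of a matrix: its operator norm on Euclidean space. -/
def spectralNorm {n : ℕ} (M : Matrix (Fin n) (Fin n) ℝ) : ℝ :=
  ‖Matrix.toEuclideanCLM (n := Fin n) (𝕜 := ℝ) M‖

/-- The largest eigenvalue of a symmetric matrix. -/
def eMax {n : ℕ} (M : Matrix (Fin n) (Fin n) ℝ) : ℝ := sSup (spectrum ℝ M)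

/-- The smallest eigenvalue of a symmetric matrix. -/
def eMin {n : ℕ} (M : Matrix (Fin n) (Fin n) ℝ) : ℝ := sInf (spectrum ℝ M)

/-- The spread of the spectrum of a symmetric matrix. -/
def deltaE {n : ℕ} (M : Matrix (Fin n) (Fin n) ℝ) : ℝ := eMax M - eMin M

/-- Feasibility of the semidefinite program: some density matrix satisfies `Tr[A i X] = b i`
for all `i`. -/
def Feasible {n m : ℕ} (A : Fin m → Matrix (Fin n) (Fin n) ℝ)
    (b : EuclideanSpace ℝ (Fin m)) : Prop :=
  ∃ X ∈ densityMatrices n, ∀ i, (A i * X).trace = b i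

/-- The Lagrangian of the entropically regularized semidefinite program, in which only the
constraints `Tr[A i X] = b i` are dualized. -/
def lagrangian {n m : ℕ} (C : Matrix (Fin n) (Fin n) ℝ) (A : Fin m → Matrix (Fin n) (Fin n) ℝ)
    (b : EuclideanSpace ℝ (Fin m)) (β : ℝ) (X : Matrix (Fin n) (Fin n) ℝ)
    (lam : EuclideanSpace ℝ (Fin m)) : ℝ :=
  (C * X).trace + β⁻¹ * entropy X - ∑ i, lam i * ((A i * X).trace - b i)

/-- The dual objective (to be maximized): the minimum of the Lagrangian over the density
matrices. The minimum is over a compact set, which is nonempty for `1 ≤ n`. -/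
def dualObjective {n m : ℕ} (C : Matrix (Fin n) (Fin n) ℝ)
    (A : Fin m → Matrix (Fin n) (Fin n) ℝ) (b : EuclideanSpace ℝ (Fin m)) (β : ℝ)
    (lam : EuclideanSpace ℝ (Fin m)) : ℝ :=
  sInf ((fun X => lagrangian C A b β X lam) '' densityMatrices n)

/-- The negative dual objective `f_β` (to be minimized). -/
def negDual {n m : ℕ} (C : Matrix (Fin n) (Fin n) ℝ)
    (A : Fin m → Matrix (Fin n) (Fin n) ℝ) (b : EuclideanSpace ℝ (Fin m)) (β : ℝ)
    (lam : EuclideanSpace ℝ (Fin m)) : ℝ :=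
  -dualObjective C A b β lam

/-- The norm dual to `N`, namely `x ↦ sup {x · y | N y ≤ 1}`. -/
def dualNorm {m : ℕ} (N : Seminorm ℝ (EuclideanSpace ℝ (Fin m)))
    (x : EuclideanSpace ℝ (Fin m)) : ℝ :=
  sSup ((fun y => inner ℝ x y) '' {y | N y ≤ 1})

/-- The iterates `lam 0, …, lam T` are produced by `T` steps of gradient descent on `f` with
respect to the norm `N`, with gradient estimates `g 0, …, g (T - 1)`, step size `η` and initial
point `0`. Each iterate may be any minimizer of the local model at the preceding one. -/
def IsGradientDescent {m : ℕ} (N : Seminorm ℝ (EuclideanSpace ℝ (Fin m)))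
    (f : EuclideanSpace ℝ (Fin m) → ℝ) (η : ℝ) (T : ℕ)
    (g lam : ℕ → EuclideanSpace ℝ (Fin m)) : Prop :=
  lam 0 = 0 ∧ ∀ t < T,
    IsMinOn (fun x => f (lam t) + inner ℝ (g t) (x - lam t) + 1 / (2 * η) * N (x - lam t) ^ 2)
      Set.univ (lam (t + 1))

end EntropicSDP

end

open Matrix

namespace EntropicSDP

/-! ### A scalar inequality -/

/-! The multipliers only shift the cost matrix, so the inner minimum is attained at the Gibbs state
of $C-\lambda\cdot A$. A dual form of Pinsker's inequality (`exists_gibbs_state`) then sandwiches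
$f_\beta$ between its linear model and a quadratic model of curvature $\beta$ in the norm $N$
(`exists_gradient_negDual`). This gives both differentiability and $\beta$-smoothness.

Pinsker reduces to a scalar inequality summed over pairs (eigenvector $v_i$ of $X$, eigenvector
$w_j$ of the Gibbs state): the squared overlaps form a doubly stochastic matrix, so no operator
calculus is needed.

With step $1/\beta$, smoothness makes each step decrease $f_\beta$ by an amount governed by the dual
norm of $g_t$ (`descent_step`). A feasible state bounds $f_\beta(0)-f_\beta(\lambda)$ by $\Delta
e(C)+\beta^{-1}\log n$ uniformly in $\lambda$ (`lagrangian_sub_lagrangian_zero_le`), so the gradient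
cannot stay large for $T$ steps. -/

theorem log_sub_hasDerivAt {t : ℝ} (ht : 0 < t) :
    HasDerivAt (fun t : ℝ => Real.log t - (t - 1) * (5 * t + 1) / (2 * t * (t + 2)))
      ((t - 1) ^ 3 / (t ^ 2 * (t + 2) ^ 2)) t := by
  have h1 : HasDerivAt (fun t : ℝ => (t - 1) * (5 * t + 1))
      (1 * (5 * t + 1) + (t - 1) * (5 * 1)) t :=
    ((hasDerivAt_id t).sub_const 1).mul (((hasDerivAt_id t).const_mul 5).add_const 1)
  have h2 : HasDerivAt (fun t : ℝ => 2 * t * (t + 2))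
      (2 * 1 * (t + 2) + 2 * t * 1) t :=
    ((hasDerivAt_id t).const_mul 2).mul ((hasDerivAt_id t).add_const 2)
  have h3 : 2 * t * (t + 2) ≠ 0 := by positivity
  refine ((Real.hasDerivAt_log ht.ne').sub (h1.div h2 h3)).congr_deriv ?_
  have : t + 2 ≠ 0 := by positivity
  field_simp
  ring

/-- The difference of the two sides vanishes at $1$ and its derivative has the sign of $(t-1)^3$, so
$1$ is its minimum. This rational minorant is the one that yields the denominator $x+2y$ after
substituting $t=x/y$. -/
theorem div_le_log {t : ℝ} (ht : 0 < t) :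
    (t - 1) * (5 * t + 1) / (2 * t * (t + 2)) ≤ Real.log t := by
  set h : ℝ → ℝ := fun t => Real.log t - (t - 1) * (5 * t + 1) / (2 * t * (t + 2)) with hh
  have h1 : h 1 = 0 := by simp [hh]
  suffices h 1 ≤ h t by rw [h1] at this; simpa [hh] using this
  rcases le_total 1 t with h1t | h1t
  · have : MonotoneOn h (Set.Ici 1) := by
      refine monotoneOn_of_deriv_nonneg (convex_Ici 1)
        (fun x hx => (log_sub_hasDerivAt (lt_of_lt_of_le one_pos hx)).continuousAt.continuousWithinAt)
        (fun x hx => ?_) (fun x hx => ?_) <;> rw [interior_Ici] at hx <;>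
        have hx0 : (0 : ℝ) < x := lt_trans one_pos hx
      · exact (log_sub_hasDerivAt hx0).differentiableAt.differentiableWithinAt
      · rw [(log_sub_hasDerivAt hx0).deriv]
        have : 0 ≤ x - 1 := sub_nonneg.2 (le_of_lt hx)
        positivity
    exact this (by simp) h1t h1t
  · have : AntitoneOn h (Set.Ioc 0 1) := by
      refine antitoneOn_of_deriv_nonpos (convex_Ioc 0 1)
        (fun x hx => (log_sub_hasDerivAt hx.1).continuousAt.continuousWithinAt)
        (fun x hx => ?_) (fun x hx => ?_) <;> rw [interior_Ioc] at hx
      · exact (log_sub_hasDerivAt hx.1).differentiableAt.differentiableWithinAt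
      · rw [(log_sub_hasDerivAt hx.1).deriv]
        have h0 : 0 ≤ (1 - x) ^ 3 := pow_nonneg (sub_nonneg.2 hx.2.le) 3
        exact div_nonpos_of_nonpos_of_nonneg (by linarith [show (1 - x) ^ 3 = -(x - 1) ^ 3 by ring])
          (by positivity)
    exact this ⟨ht, h1t⟩ ⟨one_pos, le_rfl⟩ h1t

/-- A quadratic lower bound for the Bregman divergence of `x log x`. -/
theorem sq_sub_div_le_mul_log {x y : ℝ} (hx : 0 ≤ x) (hy : 0 < y) :
    3 / 2 * ((x - y) ^ 2 / (x + 2 * y)) ≤ x * (Real.log x - Real.log y) - x + y := by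
  rcases hx.eq_or_lt with rfl | hx
  · have : (0 - y) ^ 2 / (0 + 2 * y) = y / 2 := by field_simp; ring
    rw [this]; linarith
  · have h := mul_le_mul_of_nonneg_left (div_le_log (div_pos hx hy)) hx.le
    rw [Real.log_div hx.ne' hy.ne'] at h
    have h2 : x * ((x / y - 1) * (5 * (x / y) + 1) / (2 * (x / y) * (x / y + 2)))
        = 3 / 2 * ((x - y) ^ 2 / (x + 2 * y)) + x - y := by
      have : x + 2 * y ≠ 0 := by positivity
      have : x / y + 2 ≠ 0 := by positivity
      field_simp
      ring
    linarith

/-- Young's inequality with weight $x+2y$, applied to the quadratic lower bound. For two probability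
vectors these weights contribute total mass $1+2=3$, which turns $\beta/6$ into the Pinsker constant
$\beta/2$. -/
theorem mul_le_mul_log_add {x y β : ℝ} (hx : 0 ≤ x) (hy : 0 < y) (hβ : 0 < β) (u v : ℝ) :
    (x - y) * (u * v) ≤ β⁻¹ * (u ^ 2 * (x * (Real.log x - Real.log y) - x + y)) +
      β / 6 * ((x + 2 * y) * v ^ 2) := by
  have h := mul_le_mul_of_nonneg_left (mul_le_mul_of_nonneg_left (sq_sub_div_le_mul_log hx hy)
    (sq_nonneg u)) (inv_pos.2 hβ).le
  have hw : 0 < x + 2 * y := by positivity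
  have h2 : β⁻¹ * (u ^ 2 * (3 / 2 * ((x - y) ^ 2 / (x + 2 * y)))) + β / 6 * ((x + 2 * y) * v ^ 2)
      - (x - y) * (u * v)
      = 3 / 2 * ((x - y) * u - β * (x + 2 * y) * v / 3) ^ 2 / (β * (x + 2 * y)) := by
    field_simp
    ring
  have h3 : 0 ≤ 3 / 2 * ((x - y) * u - β * (x + 2 * y) * v / 3) ^ 2 / (β * (x + 2 * y)) := by
    positivity
  linarith

/-! ### Traces in orthonormal bases -/

/-- The operator on Euclidean space given by a matrix. -/
noncomputable abbrev euclideanOp {n : ℕ} (M : Matrix (Fin n) (Fin n) ℝ) :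
    EuclideanSpace ℝ (Fin n) →L[ℝ] EuclideanSpace ℝ (Fin n) :=
  Matrix.toEuclideanCLM (n := Fin n) (𝕜 := ℝ) M

variable {n m : ℕ}

theorem trace_eq_sum_inner_euclideanOp {ι : Type*} [Fintype ι] (M : Matrix (Fin n) (Fin n) ℝ)
    (v : OrthonormalBasis ι ℝ (EuclideanSpace ℝ (Fin n))) :
    M.trace = ∑ i, inner ℝ (v i) (euclideanOp M (v i)) := by
  have h := LinearMap.trace_eq_sum_inner (Matrix.toEuclideanLin M) v
  have h2 : LinearMap.trace ℝ _ (Matrix.toEuclideanLin M) = M.trace := by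
    rw [LinearMap.trace_eq_sum_inner _ (EuclideanSpace.basisFun (Fin n) ℝ), Matrix.trace]
    refine Finset.sum_congr rfl fun i _ => ?_
    simp [Matrix.toLpLin_apply, EuclideanSpace.inner_single_left]
  rw [← h2, h]
  rfl

theorem inner_euclideanOp_comm {M : Matrix (Fin n) (Fin n) ℝ} (hM : M.IsHermitian)
    (x y : EuclideanSpace ℝ (Fin n)) :
    inner ℝ (euclideanOp M x) y = inner ℝ x (euclideanOp M y) :=
  isSymmetric_toEuclideanLin_iff.mpr hM x y

theorem euclideanOp_eigenvectorBasis {M : Matrix (Fin n) (Fin n) ℝ} (hM : M.IsHermitian)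
    (i : Fin n) :
    euclideanOp M (hM.eigenvectorBasis i) = hM.eigenvalues i • hM.eigenvectorBasis i := by
  have := hM.mulVec_eigenvectorBasis i
  ext k
  simpa using congrFun this k

theorem trace_mul_eq_sum {ι : Type*} [Fintype ι] (M : Matrix (Fin n) (Fin n) ℝ)
    {X : Matrix (Fin n) (Fin n) ℝ} (v : OrthonormalBasis ι ℝ (EuclideanSpace ℝ (Fin n)))
    {x : ι → ℝ} (hX : ∀ i, euclideanOp X (v i) = x i • v i) :
    (M * X).trace = ∑ i, x i * inner ℝ (v i) (euclideanOp M (v i)) := by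
  rw [trace_eq_sum_inner_euclideanOp _ v]
  refine Finset.sum_congr rfl fun i _ => ?_
  rw [euclideanOp, map_mul, mul_apply_eq_comp, hX, map_smul, inner_smul_right]

theorem entropy_eq_sum {X : Matrix (Fin n) (Fin n) ℝ} (hX : X.IsHermitian) :
    entropy X = ∑ i, hX.eigenvalues i * Real.log (hX.eigenvalues i) := by
  rw [entropy, hX.cfc_eq, IsHermitian.cfc, Unitary.conjStarAlgAut_apply, Matrix.trace_mul_cycle]
  simp [Matrix.trace]

theorem sum_sq_inner {ι : Type*} [Fintype ι]
    (v : OrthonormalBasis ι ℝ (EuclideanSpace ℝ (Fin n))) (z : EuclideanSpace ℝ (Fin n)) :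
    ∑ i, inner ℝ (v i) z ^ 2 = ‖z‖ ^ 2 := by
  rw [← real_inner_self_eq_norm_sq, ← v.sum_inner_mul_inner]
  refine Finset.sum_congr rfl fun i _ => ?_
  rw [real_inner_comm (v i) z, sq]

theorem inner_euclideanOp_self_eq_sum {ι : Type*} [Fintype ι]
    {M : Matrix (Fin n) (Fin n) ℝ} (hM : M.IsHermitian)
    (w : OrthonormalBasis ι ℝ (EuclideanSpace ℝ (Fin n))) {μ : ι → ℝ}
    (hw : ∀ j, euclideanOp M (w j) = μ j • w j) (z : EuclideanSpace ℝ (Fin n)) :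
    inner ℝ z (euclideanOp M z) = ∑ j, μ j * inner ℝ z (w j) ^ 2 := by
  rw [← w.sum_inner_mul_inner]
  refine Finset.sum_congr rfl fun i _ => ?_
  rw [← inner_euclideanOp_comm hM, hw, inner_smul_left, real_inner_comm z (w i)]
  simp only [conj_trivial]
  ring

/-- A symmetric matrix with prescribed eigenvectors and nonnegative eigenvalues. -/
theorem exists_posSemidef_of_eigenvectorBasis {M : Matrix (Fin n) (Fin n) ℝ}
    (hM : M.IsHermitian) (y : Fin n → ℝ) (hy : ∀ j, 0 ≤ y j) :
    ∃ Y : Matrix (Fin n) (Fin n) ℝ, Y.PosSemidef ∧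
      ∀ j, euclideanOp Y (hM.eigenvectorBasis j) = y j • hM.eigenvectorBasis j := by
  refine ⟨(hM.eigenvectorUnitary : Matrix _ _ ℝ) * diagonal y * (hM.eigenvectorUnitary : Matrix _ _ ℝ)ᴴ,
    (PosSemidef.diagonal hy).mul_mul_conjTranspose_same _, fun j => ?_⟩
  have h := hM.star_eigenvectorUnitary_mulVec j
  have h2 := hM.eigenvectorUnitary_mulVec j
  have h3 : diagonal y *ᵥ Pi.single j (1 : ℝ) = y j • Pi.single j (1 : ℝ) := by
    ext k
    by_cases hk : k = j
    · subst hk; simp [mulVec_diagonal]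
    · simp [mulVec_diagonal, hk]
  have : ((hM.eigenvectorUnitary : Matrix _ _ ℝ) * diagonal y * (hM.eigenvectorUnitary : Matrix _ _ ℝ)ᴴ) *ᵥ
      ⇑(hM.eigenvectorBasis j) = y j • ⇑(hM.eigenvectorBasis j) := by
    rw [← mulVec_mulVec, ← mulVec_mulVec, ← star_eq_conjTranspose, h, h3,
      mulVec_smul, h2]
  ext k
  simpa [Matrix.mul_assoc] using congrFun this k

theorem norm_euclideanOp_le_spectralNorm (H : Matrix (Fin n) (Fin n) ℝ)
    {z : EuclideanSpace ℝ (Fin n)} (hz : ‖z‖ = 1) :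
    ‖euclideanOp H z‖ ^ 2 ≤ spectralNorm H ^ 2 := by
  have h := (euclideanOp H).le_opNorm z
  rw [hz, mul_one] at h
  exact pow_le_pow_left₀ (norm_nonneg _) h 2

/-- The regularized objective `Tr[MX] + β⁻¹ Tr[X log X]`. -/
noncomputable def freeEnergy (M : Matrix (Fin n) (Fin n) ℝ) (β : ℝ)
    (X : Matrix (Fin n) (Fin n) ℝ) : ℝ :=
  (M * X).trace + β⁻¹ * entropy X

theorem sum_eigenvalues_eq_one {X : Matrix (Fin n) (Fin n) ℝ} (hX : X ∈ densityMatrices n) :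
    ∑ i, hX.1.1.eigenvalues i = 1 := by
  have h := hX.1.1.trace_eq_sum_eigenvalues
  exact h.symm.trans hX.2

/-- The free energy in excess of its minimum is the relative entropy to the Gibbs state, up to
the temperature. -/
theorem freeEnergy_eq_sum {M : Matrix (Fin n) (Fin n) ℝ} (hM : M.IsHermitian) {β : ℝ}
    (w : OrthonormalBasis (Fin n) ℝ (EuclideanSpace ℝ (Fin n))) {y : Fin n → ℝ} {c : ℝ}
    (hw : ∀ j, euclideanOp M (w j) = (-(β⁻¹ * Real.log (y j)) - c) • w j)
    {X : Matrix (Fin n) (Fin n) ℝ} (hX : X ∈ densityMatrices n) :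
    freeEnergy M β X = β⁻¹ * (∑ i, ∑ j, inner ℝ (hX.1.1.eigenvectorBasis i) (w j) ^ 2 *
      (hX.1.1.eigenvalues i * (Real.log (hX.1.1.eigenvalues i) - Real.log (y j)))) - c := by
  rw [freeEnergy, trace_mul_eq_sum M _ (euclideanOp_eigenvectorBasis hX.1.1),
    entropy_eq_sum hX.1.1]
  set x := hX.1.1.eigenvalues with hx
  set v := hX.1.1.eigenvectorBasis with hv
  -- Parseval: the squared overlaps are weights summing to one, so single sums over $i$ can be
  -- spread over pairs $(i,j)$.
  have hu : ∀ i, ∑ j, inner ℝ (v i) (w j) ^ 2 = 1 := fun i => by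
    have := sum_sq_inner w (v i)
    simp_rw [real_inner_comm (v i)] at this
    rw [this]; simp
  have hc : c = ∑ i, x i * c := by rw [← Finset.sum_mul, sum_eigenvalues_eq_one hX, one_mul]
  conv_rhs => rw [hc]
  rw [Finset.mul_sum, Finset.mul_sum, ← Finset.sum_add_distrib, ← Finset.sum_sub_distrib]
  refine Finset.sum_congr rfl fun i _ => ?_
  rw [inner_euclideanOp_self_eq_sum hM w hw]
  have h1 : x i * Real.log (x i) = ∑ j, inner ℝ (v i) (w j) ^ 2 * (x i * Real.log (x i)) := by
    rw [← Finset.sum_mul, hu, one_mul]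
  have h2 : x i * c = ∑ j, inner ℝ (v i) (w j) ^ 2 * (x i * c) := by
    rw [← Finset.sum_mul, hu, one_mul]
  rw [h1, h2, Finset.mul_sum, Finset.mul_sum, Finset.mul_sum, ← Finset.sum_add_distrib,
    ← Finset.sum_sub_distrib]
  refine Finset.sum_congr rfl fun j _ => ?_
  ring

/-- The Gibbs state minimizes the free energy, and the excess free energy controls linear
functionals; this is the dual form of the quantum Pinsker inequality. -/
theorem exists_gibbs_state [Nonempty (Fin n)] {M : Matrix (Fin n) (Fin n) ℝ}
    (hM : M.IsHermitian) {β : ℝ} (hβ : 0 < β) :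
    ∃ Y ∈ densityMatrices n, ∀ X ∈ densityMatrices n, ∀ H : Matrix (Fin n) (Fin n) ℝ,
      H.IsHermitian → (H * X).trace - (H * Y).trace ≤
        freeEnergy M β X - freeEnergy M β Y + β / 2 * spectralNorm H ^ 2 := by
  set μ := hM.eigenvalues with hμ
  set w := hM.eigenvectorBasis with hw
  set Z : ℝ := ∑ j, Real.exp (-β * μ j) with hZ
  have hZ0 : 0 < Z := Finset.sum_pos (fun j _ => Real.exp_pos _) Finset.univ_nonempty
  set y : Fin n → ℝ := fun j => Real.exp (-β * μ j) / Z with hy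
  have hy0 : ∀ j, 0 < y j := fun j => div_pos (Real.exp_pos _) hZ0
  have hy1 : ∑ j, y j = 1 := by rw [hy, ← Finset.sum_div, div_self hZ0.ne']
  -- Reads the eigenvalues of $M$ off the Gibbs weights; the minimal free energy is then
  -- $-\beta^{-1}\log Z$.
  have hMw : ∀ j, euclideanOp M (w j) = (-(β⁻¹ * Real.log (y j)) - β⁻¹ * Real.log Z) • w j := by
    intro j
    rw [hw, euclideanOp_eigenvectorBasis hM j, hy]
    congr 1
    simp only
    rw [Real.log_div (Real.exp_pos _).ne' hZ0.ne', Real.log_exp]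
    field_simp
    ring
  obtain ⟨Y, hYpos, hYw⟩ := exists_posSemidef_of_eigenvectorBasis hM y fun j => (hy0 j).le
  have hY : Y ∈ densityMatrices n := by
    refine ⟨hYpos, ?_⟩
    have := trace_mul_eq_sum 1 w hYw
    rw [one_mul] at this
    simpa [euclideanOp, hy1] using this
  refine ⟨Y, hY, fun X hX H hH => ?_⟩
  rw [freeEnergy_eq_sum hM w hMw hX, freeEnergy_eq_sum hM w hMw hY]
  -- The chosen eigenbasis of `Y` need not be `w`. In each term either the eigenvalues agree and the
  -- logarithms cancel, or the eigenvectors are orthogonal.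
  have hY0 : ∑ i, ∑ j, inner ℝ (hY.1.1.eigenvectorBasis i) (w j) ^ 2 *
      (hY.1.1.eigenvalues i * (Real.log (hY.1.1.eigenvalues i) - Real.log (y j))) = 0 := by
    refine Finset.sum_eq_zero fun i _ => Finset.sum_eq_zero fun j _ => ?_
    by_cases h : hY.1.1.eigenvalues i = y j
    · simp [h]
    · have h1 := inner_euclideanOp_comm hY.1.1 (hY.1.1.eigenvectorBasis i) (w j)
      rw [euclideanOp_eigenvectorBasis, hYw, inner_smul_left, inner_smul_right] at h1
      have h2 : inner ℝ (hY.1.1.eigenvectorBasis i) (w j) = 0 := by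
        simp only [conj_trivial] at h1
        have := sub_eq_zero.2 h1
        rw [← sub_mul] at this
        exact (mul_eq_zero.1 this).resolve_left (sub_ne_zero.2 h)
      simp [h2]
  rw [hY0, trace_mul_eq_sum H _ (euclideanOp_eigenvectorBasis hX.1.1), trace_mul_eq_sum H w hYw]
  have hx0 : ∀ i, 0 ≤ hX.1.1.eigenvalues i := hX.1.eigenvalues_nonneg
  have hx1 := sum_eigenvalues_eq_one hX
  set x := hX.1.1.eigenvalues with hx
  set v := hX.1.1.eigenvectorBasis with hv
  have hu : ∀ i, ∑ j, inner ℝ (v i) (w j) ^ 2 = 1 := fun i => by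
    have := sum_sq_inner w (v i)
    simp_rw [real_inner_comm (v i)] at this
    rw [this]; simp
  have hu' : ∀ j, ∑ i, inner ℝ (v i) (w j) ^ 2 = 1 := fun j => by
    rw [sum_sq_inner v (w j)]; simp
  have e1 : ∑ i, x i * inner ℝ (v i) (euclideanOp H (v i)) =
      ∑ i, ∑ j, x i * (inner ℝ (v i) (w j) * inner ℝ (w j) (euclideanOp H (v i))) := by
    refine Finset.sum_congr rfl fun i _ => ?_
    rw [← Finset.mul_sum, w.sum_inner_mul_inner]
  have e2 : ∑ j, y j * inner ℝ (w j) (euclideanOp H (w j)) =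
      ∑ i, ∑ j, y j * (inner ℝ (v i) (w j) * inner ℝ (w j) (euclideanOp H (v i))) := by
    rw [Finset.sum_comm]
    refine Finset.sum_congr rfl fun j _ => ?_
    rw [← Finset.mul_sum, ← inner_euclideanOp_comm hH, ← v.sum_inner_mul_inner]
    congr 1
    refine Finset.sum_congr rfl fun i _ => ?_
    rw [inner_euclideanOp_comm hH, mul_comm]
  -- The linear terms of the Bregman divergence cancel, as both states have trace one and the
  -- overlaps are doubly stochastic.
  have e3 : ∑ i, ∑ j, inner ℝ (v i) (w j) ^ 2 * (-x i + y j) = 0 := by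
    simp_rw [mul_add, Finset.sum_add_distrib]
    rw [Finset.sum_comm (f := fun i j => inner ℝ (v i) (w j) ^ 2 * y j)]
    simp_rw [← Finset.sum_mul, hu, hu', one_mul, Finset.sum_neg_distrib, hx1, hy1]
    norm_num
  -- Parseval in `w` for the `x` part and in `v` for the `y` part leaves averages of $\|Hv_i\|^2$
  -- and $\|Hw_j\|^2$.
  have e4 : ∑ i, ∑ j, (x i + 2 * y j) * inner ℝ (w j) (euclideanOp H (v i)) ^ 2 ≤
      3 * spectralNorm H ^ 2 := by
    simp_rw [add_mul, Finset.sum_add_distrib]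
    rw [Finset.sum_comm (f := fun i j => 2 * y j * inner ℝ (w j) (euclideanOp H (v i)) ^ 2)]
    simp_rw [← Finset.mul_sum, sum_sq_inner w]
    have h3 : ∀ j, ∑ i, inner ℝ (w j) (euclideanOp H (v i)) ^ 2 = ‖euclideanOp H (w j)‖ ^ 2 := by
      intro j
      rw [← sum_sq_inner v]
      refine Finset.sum_congr rfl fun i _ => ?_
      rw [← inner_euclideanOp_comm hH, real_inner_comm]
    simp_rw [h3]
    have a1 : ∑ i, x i * ‖euclideanOp H (v i)‖ ^ 2 ≤ ∑ i, x i * spectralNorm H ^ 2 :=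
      Finset.sum_le_sum fun i _ => mul_le_mul_of_nonneg_left
        (norm_euclideanOp_le_spectralNorm H (v.norm_eq_one i)) (hx0 i)
    have a2 : ∑ j, 2 * y j * ‖euclideanOp H (w j)‖ ^ 2 ≤ ∑ j, 2 * y j * spectralNorm H ^ 2 :=
      Finset.sum_le_sum fun j _ => mul_le_mul_of_nonneg_left
        (norm_euclideanOp_le_spectralNorm H (w.norm_eq_one j)) (by linarith [hy0 j])
    rw [← Finset.sum_mul, hx1] at a1
    rw [← Finset.sum_mul, ← Finset.mul_sum, hy1] at a2
    linarith
  have key := Finset.sum_le_sum fun i (_ : i ∈ Finset.univ) =>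
    Finset.sum_le_sum fun j (_ : j ∈ Finset.univ) =>
      mul_le_mul_log_add (hx0 i) (hy0 j) hβ (inner ℝ (v i) (w j))
        (inner ℝ (w j) (euclideanOp H (v i)))
  simp_rw [Finset.sum_add_distrib, ← Finset.mul_sum, sub_mul, Finset.sum_sub_distrib] at key
  have e5 : ∑ i, ∑ j, inner ℝ (v i) (w j) ^ 2 * (x i * (Real.log (x i) - Real.log (y j)) - x i + y j)
      = ∑ i, ∑ j, inner ℝ (v i) (w j) ^ 2 * (x i * (Real.log (x i) - Real.log (y j))) := by
    rw [← add_zero (∑ i, ∑ j, inner ℝ (v i) (w j) ^ 2 * (x i * (Real.log (x i) - Real.log (y j)))),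
      ← e3, ← Finset.sum_add_distrib]
    refine Finset.sum_congr rfl fun i _ => ?_
    rw [← Finset.sum_add_distrib]
    exact Finset.sum_congr rfl fun j _ => by ring
  rw [e5] at key
  rw [e1, e2]
  have := mul_le_mul_of_nonneg_left e4 (by positivity : 0 ≤ β / 6)
  linarith

/-! ### Bounds on the entropy and on linear functionals -/

theorem entropy_nonpos {X : Matrix (Fin n) (Fin n) ℝ} (hX : X ∈ densityMatrices n) :
    entropy X ≤ 0 := by
  rw [entropy_eq_sum hX.1.1]
  refine Finset.sum_nonpos fun i _ => ?_
  have h0 := hX.1.eigenvalues_nonneg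
  have h1 : hX.1.1.eigenvalues i ≤ 1 := by
    refine le_of_le_of_eq ?_ (sum_eigenvalues_eq_one hX)
    exact Finset.single_le_sum (fun j _ => h0 j) (Finset.mem_univ i)
  exact mul_nonpos_of_nonneg_of_nonpos (h0 i) (Real.log_nonpos (h0 i) h1)

/-- Gibbs' inequality against the maximally mixed state, from $1-1/s\le\log s$ at $s=nx_i$; a zero
eigenvalue is treated apart. -/
theorem neg_log_le_entropy {X : Matrix (Fin n) (Fin n) ℝ} (hX : X ∈ densityMatrices n)
    [Nonempty (Fin n)] : -Real.log n ≤ entropy X := by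
  have hn : (0 : ℝ) < n := by exact_mod_cast Fin.pos_iff_nonempty.2 ‹_›
  rw [entropy_eq_sum hX.1.1]
  have h : ∀ i, hX.1.1.eigenvalues i - 1 / n - hX.1.1.eigenvalues i * Real.log n ≤
      hX.1.1.eigenvalues i * Real.log (hX.1.1.eigenvalues i) := fun i => by
    rcases (hX.1.eigenvalues_nonneg i).eq_or_lt with h0 | h0
    · rw [← h0]; simp
    · have := mul_le_mul_of_nonneg_left (Real.one_sub_inv_le_log_of_pos (mul_pos h0 hn)) h0.le
      rw [Real.log_mul h0.ne' hn.ne'] at this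
      have e : hX.1.1.eigenvalues i * (1 - (hX.1.1.eigenvalues i * n)⁻¹) =
        hX.1.1.eigenvalues i - 1 / n := by field_simp
      linarith
  refine le_trans (le_of_eq ?_) (Finset.sum_le_sum fun i _ => h i)
  rw [Finset.sum_sub_distrib, Finset.sum_sub_distrib, ← Finset.sum_mul, sum_eigenvalues_eq_one hX]
  simp [hn.ne']

/-- The trace is a twofold convex combination of eigenvalues of `M`, weighted by squared overlaps
and then by the eigenvalues of `X`. -/
theorem trace_mul_mem_Icc {M X : Matrix (Fin n) (Fin n) ℝ} (hM : M.IsHermitian)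
    (hX : X ∈ densityMatrices n) : (M * X).trace ∈ Set.Icc (eMin M) (eMax M) := by
  have hfin : (spectrum ℝ M).Finite := Matrix.finite_real_spectrum
  have hb : ∀ j, hM.eigenvalues j ∈ Set.Icc (eMin M) (eMax M) := fun j =>
    ⟨csInf_le hfin.bddBelow (hM.eigenvalues_mem_spectrum_real j),
      le_csSup hfin.bddAbove (hM.eigenvalues_mem_spectrum_real j)⟩
  have hv : ∀ i, ∑ j, inner ℝ (hX.1.1.eigenvectorBasis i) (hM.eigenvectorBasis j) ^ 2 = 1 :=
    fun i => by
      have := sum_sq_inner hM.eigenvectorBasis (hX.1.1.eigenvectorBasis i)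
      simp_rw [real_inner_comm (hX.1.1.eigenvectorBasis i)] at this
      rw [this]; simp
  have hq : ∀ i, inner ℝ (hX.1.1.eigenvectorBasis i)
      (euclideanOp M (hX.1.1.eigenvectorBasis i)) ∈ Set.Icc (eMin M) (eMax M) := fun i => by
    rw [inner_euclideanOp_self_eq_sum hM _ (euclideanOp_eigenvectorBasis hM)]
    simp_rw [mul_comm (hM.eigenvalues _)]
    exact (convex_Icc _ _).sum_mem (fun j _ => sq_nonneg _) (hv i) fun j _ => hb j
  rw [trace_mul_eq_sum M _ (euclideanOp_eigenvectorBasis hX.1.1)]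
  exact (convex_Icc _ _).sum_mem (fun j _ => hX.1.eigenvalues_nonneg j)
    (sum_eigenvalues_eq_one hX) fun j _ => hq j

/-! ### The dual norm -/

section DualNorm

variable {N : Seminorm ℝ (EuclideanSpace ℝ (Fin m))}

theorem seminorm_continuous (N : Seminorm ℝ (EuclideanSpace ℝ (Fin m))) : Continuous N :=
  continuousOn_univ.1 (N.convexOn.continuousOn isOpen_univ)

/-- Compactness of the unit sphere, which is empty when `m = 0`. It makes the supremum in `dualNorm`
range over a bounded set, so that `sSup` is a genuine supremum. -/
theorem exists_pos_mul_norm_le (hN : ∀ x, N x = 0 → x = 0) : ∃ c > 0, ∀ x, c * ‖x‖ ≤ N x := by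
  rcases (Metric.sphere (0 : EuclideanSpace ℝ (Fin m)) 1).eq_empty_or_nonempty with h | h
  · refine ⟨1, one_pos, fun x => ?_⟩
    by_contra! hx
    have hx0 : ‖x‖ ≠ 0 := fun h0 => by
      rw [h0, mul_zero] at hx; exact absurd hx (not_lt.2 (apply_nonneg N x))
    have : ‖x‖⁻¹ • x ∈ Metric.sphere (0 : EuclideanSpace ℝ (Fin m)) 1 := by
      simp [norm_smul, hx0]
    rw [h] at this
    exact this
  · obtain ⟨z, hz, hmin⟩ := (isCompact_sphere (0 : EuclideanSpace ℝ (Fin m)) 1).exists_isMinOn h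
      (seminorm_continuous N).continuousOn
    have hz1 : ‖z‖ = 1 := by simpa using hz
    refine ⟨N z, lt_of_le_of_ne (apply_nonneg N z) fun h0 => ?_, fun x => ?_⟩
    · rw [hN z h0.symm, norm_zero] at hz1
      exact zero_ne_one hz1
    · rcases eq_or_ne x 0 with rfl | hx
      · simp
      · have hx0 : 0 < ‖x‖ := norm_pos_iff.2 hx
        have h1 := hmin (show ‖x‖⁻¹ • x ∈ Metric.sphere (0 : EuclideanSpace ℝ (Fin m)) 1 by
          simp [norm_smul, hx0.ne'])
        have h2 : N z ≤ ‖x‖⁻¹ * N x := by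
          simpa [map_smul_eq_mul] using h1
        rwa [← div_eq_inv_mul, le_div_iff₀ hx0] at h2

theorem inner_le_dualNorm (hN : ∀ x, N x = 0 → x = 0) (x : EuclideanSpace ℝ (Fin m))
    {y : EuclideanSpace ℝ (Fin m)} (hy : N y ≤ 1) : inner ℝ x y ≤ dualNorm N x := by
  obtain ⟨c, hc, h⟩ := exists_pos_mul_norm_le hN
  refine le_csSup ⟨‖x‖ * c⁻¹, ?_⟩ ⟨y, hy, rfl⟩
  rintro _ ⟨z, hz, rfl⟩
  refine (real_inner_le_norm x z).trans (mul_le_mul_of_nonneg_left ?_ (norm_nonneg x))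
  rw [← one_div, le_div_iff₀ hc, mul_comm]
  exact (h z).trans hz

theorem dualNorm_le {x : EuclideanSpace ℝ (Fin m)} {a : ℝ}
    (h : ∀ y, N y ≤ 1 → inner ℝ x y ≤ a) : dualNorm N x ≤ a := by
  refine csSup_le ⟨_, 0, by simp, rfl⟩ ?_
  rintro _ ⟨z, hz, rfl⟩
  exact h z hz

theorem dualNorm_nonneg (hN : ∀ x, N x = 0 → x = 0) (x : EuclideanSpace ℝ (Fin m)) :
    0 ≤ dualNorm N x := by
  simpa using inner_le_dualNorm hN x (y := 0) (by simp)

theorem inner_le_dualNorm_mul (hN : ∀ x, N x = 0 → x = 0) (x y : EuclideanSpace ℝ (Fin m)) :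
    inner ℝ x y ≤ dualNorm N x * N y := by
  rcases (apply_nonneg N y).eq_or_lt with h | h
  · rw [hN y h.symm]; simp
  · have := inner_le_dualNorm hN x (y := (N y)⁻¹ • y) (by
      rw [map_smul_eq_mul, Real.norm_of_nonneg (inv_nonneg.2 h.le), inv_mul_cancel₀ h.ne'])
    rwa [inner_smul_right, ← div_eq_inv_mul, div_le_iff₀ h] at this

theorem dualNorm_le_add_dualNorm_sub (hN : ∀ x, N x = 0 → x = 0)
    (x y : EuclideanSpace ℝ (Fin m)) : dualNorm N y ≤ dualNorm N x + dualNorm N (x - y) := by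
  refine dualNorm_le fun z hz => ?_
  have h1 := inner_le_dualNorm hN x hz
  have h2 := inner_le_dualNorm hN (x - y) (y := -z) (by rwa [map_neg_eq_map])
  rw [inner_neg_right, inner_sub_left] at h2
  linarith

end DualNorm

/-! ### Gradient descent with inexact gradients -/

section Descent

variable {N : Seminorm ℝ (EuclideanSpace ℝ (Fin m))} {β : ℝ} {g d : EuclideanSpace ℝ (Fin m)}

/-- Stationarity along the ray through the minimizer: $s\mapsto sa+s^2B$ is minimal at $s=1$, so
$a+2B=0$. -/
theorem inner_eq_of_isMinOn_model
    (h : ∀ z, inner ℝ g d + β / 2 * N d ^ 2 ≤ inner ℝ g z + β / 2 * N z ^ 2) (hβ : 0 < β) :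
    inner ℝ g d = -(β * N d ^ 2) := by
  set a := inner ℝ g d
  set B := β / 2 * N d ^ 2 with hB
  have hB0 : 0 ≤ B := by positivity
  have h1 : ∀ s : ℝ, a + B ≤ s * a + s ^ 2 * B := fun s => by
    have := h (s • d)
    rw [inner_smul_right, map_smul_eq_mul, mul_pow, Real.norm_eq_abs, sq_abs] at this
    linarith [this, show s ^ 2 * B = β / 2 * (s ^ 2 * N d ^ 2) by rw [hB]; ring]
  -- With $q=(a+2B)/(B+1)$, testing $s=1-q$ changes the model by exactly $-q^2$; the $+1$ keeps the
  -- denominator positive even if $B=0$.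
  have h2 := h1 (1 - (a + 2 * B) / (B + 1))
  have h3 : (1 - (a + 2 * B) / (B + 1)) * a + (1 - (a + 2 * B) / (B + 1)) ^ 2 * B - (a + B) =
      -((a + 2 * B) / (B + 1)) ^ 2 := by
    have : B + 1 ≠ 0 := by positivity
    field_simp
    ring
  have h4 : ((a + 2 * B) / (B + 1)) ^ 2 = 0 := le_antisymm (by linarith) (sq_nonneg _)
  have h5 : a + 2 * B = 0 := by
    have := pow_eq_zero_iff (two_ne_zero) |>.1 h4
    rcases div_eq_zero_iff.1 this with h | h
    · exact h
    · linarith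
  linarith

theorem mul_seminorm_eq_dualNorm_of_isMinOn_model (hN : ∀ x, N x = 0 → x = 0)
    (h : ∀ z, inner ℝ g d + β / 2 * N d ^ 2 ≤ inner ℝ g z + β / 2 * N z ^ 2) (hβ : 0 < β) :
    β * N d = dualNorm N g := by
  have ha := inner_eq_of_isMinOn_model h hβ
  have hd := apply_nonneg N d
  apply le_antisymm
  · have h1 := inner_le_dualNorm_mul hN g (-d)
    rw [inner_neg_right, map_neg_eq_map, ha, neg_neg] at h1
    rcases hd.eq_or_lt with h0 | h0
    · rw [← h0, mul_zero]; exact dualNorm_nonneg hN g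
    · exact le_of_mul_le_mul_right (by linarith [sq (N d)]) h0
  · refine dualNorm_le fun y hy => ?_
    -- This is the optimal multiple of `y` for the model when `N y = 1`.
    have h1 := h (-(inner ℝ g y / β) • y)
    rw [inner_smul_right, map_smul_eq_mul, mul_pow, Real.norm_eq_abs, sq_abs, ha] at h1
    set c := inner ℝ g y
    have h2 : N y ^ 2 ≤ 1 := pow_le_one₀ (apply_nonneg N y) hy
    have h3 : β / 2 * ((-(c / β)) ^ 2 * N y ^ 2) ≤ β / 2 * ((-(c / β)) ^ 2 * 1) := by gcongr
    have h4 : 2 * β * (-(c / β) * c + β / 2 * ((-(c / β)) ^ 2 * 1)) = -c ^ 2 := by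
      field_simp; ring
    have h5 : c ^ 2 ≤ (β * N d) ^ 2 := by
      have : 2 * β * (-(β * N d ^ 2) + β / 2 * N d ^ 2) ≤
        2 * β * (-(c / β) * c + β / 2 * ((-(c / β)) ^ 2 * 1)) :=
        mul_le_mul_of_nonneg_left (by linarith) (by positivity)
      rw [h4] at this
      nlinarith
    exact le_of_abs_le (abs_le_of_sq_le_sq h5 (by positivity))

/-- One step of gradient descent with an inexact gradient `g`, on a function whose quadratic
model with gradient `G` is an upper bound. -/
theorem descent_step (hN : ∀ x, N x = 0 → x = 0)
    (h : ∀ z, inner ℝ g d + β / 2 * N d ^ 2 ≤ inner ℝ g z + β / 2 * N z ^ 2) (hβ : 0 < β)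
    {f₀ f₁ γ : ℝ} {G : EuclideanSpace ℝ (Fin m)}
    (hf : f₁ ≤ f₀ + inner ℝ G d + β / 2 * N d ^ 2) (hγ : dualNorm N (g - G) ≤ γ) :
    2 * β * (f₁ - f₀) ≤ γ ^ 2 - (dualNorm N g - γ) ^ 2 := by
  have ha := inner_eq_of_isMinOn_model h hβ
  rw [← mul_seminorm_eq_dualNorm_of_isMinOn_model hN h hβ]
  have h1 := inner_le_dualNorm_mul hN (g - G) (-d)
  rw [inner_neg_right, map_neg_eq_map, inner_sub_left, ha] at h1
  have h2 := mul_le_mul_of_nonneg_right hγ (apply_nonneg N d)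
  have h3 : f₁ - f₀ ≤ γ * N d - β / 2 * N d ^ 2 := by linarith
  have h4 := mul_le_mul_of_nonneg_left h3 (by positivity : 0 ≤ 2 * β)
  linarith [show 2 * β * (γ * N d - β / 2 * N d ^ 2) = γ ^ 2 - (β * N d - γ) ^ 2 by ring]

/-- Gradient descent with inexact gradients finds an approximately stationary point. -/
theorem exists_dualNorm_gradient_le (hN : ∀ x, N x = 0 → x = 0)
    {f : EuclideanSpace ℝ (Fin m) → ℝ} {G : EuclideanSpace ℝ (Fin m) → EuclideanSpace ℝ (Fin m)}
    (hβ : 0 < β)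
    (hf : ∀ x y, f y ≤ f x + inner ℝ (G x) (y - x) + β / 2 * N (y - x) ^ 2)
    {γ : ℝ} (hγ : 0 ≤ γ) {T : ℕ} (hT : 1 ≤ T) {g lam : ℕ → EuclideanSpace ℝ (Fin m)}
    (hlam : IsGradientDescent N f (1 / β) T g lam)
    (hg : ∀ t < T, dualNorm N (g t - G (lam t)) ≤ γ)
    {ε : ℝ} (hε : 0 ≤ ε) (hgap : 2 * β * (f 0 - f (lam T)) ≤ T * ε ^ 2) :
    ∃ t < T, dualNorm N (G (lam t)) ≤ 3 * γ + ε := by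
  by_contra! hcon
  have step : ∀ t < T, 2 * β * (f (lam (t + 1)) - f (lam t)) < -ε ^ 2 := by
    intro t ht
    have hmin := isMinOn_univ_iff.1 (hlam.2 t ht)
    have hb : 1 / (2 * (1 / β)) = β / 2 := by field_simp
    have h : ∀ z, inner ℝ (g t) (lam (t + 1) - lam t) + β / 2 * N (lam (t + 1) - lam t) ^ 2 ≤
        inner ℝ (g t) z + β / 2 * N z ^ 2 := fun z => by
      have := hmin (lam t + z)
      simp only [hb, add_sub_cancel_left] at this
      linarith
    have h1 := descent_step hN h hβ (hf (lam t) (lam (t + 1))) (hg t ht)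
    have h2 := dualNorm_le_add_dualNorm_sub hN (g t) (G (lam t))
    have h3 := hcon t ht
    -- One $\gamma$ of the $3\gamma$ pays for passing from the gradient to `g t`, the second for the
    -- shift in `descent_step`, and the third absorbs the $\gamma^2$ there, as
    -- $(\gamma+\varepsilon)^2-\gamma^2\ge\varepsilon^2$.
    have h4 : γ + ε < dualNorm N (g t) - γ := by linarith [hg t ht]
    have h5 : (γ + ε) ^ 2 < (dualNorm N (g t) - γ) ^ 2 :=
      pow_lt_pow_left₀ h4 (by positivity) two_ne_zero
    nlinarith [mul_nonneg hγ hε]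
  have hsum : ∑ t ∈ Finset.range T, 2 * β * (f (lam (t + 1)) - f (lam t)) <
      ∑ t ∈ Finset.range T, -ε ^ 2 :=
    Finset.sum_lt_sum_of_nonempty (Finset.nonempty_range_iff.2 (by omega))
      fun t ht => step t (Finset.mem_range.1 ht)
  rw [← Finset.mul_sum, Finset.sum_range_sub (fun t => f (lam t)), hlam.1] at hsum
  simp only [Finset.sum_const, Finset.card_range, nsmul_eq_mul] at hsum
  linarith

end Descent

/-! ### The negative dual objective -/

theorem dotMat_isHermitian {A : Fin m → Matrix (Fin n) (Fin n) ℝ} (hA : ∀ i, (A i).IsSymm)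
    (lam : EuclideanSpace ℝ (Fin m)) : (dotMat lam A).IsHermitian := by
  rw [IsHermitian, conjTranspose_eq_transpose_of_trivial, dotMat, transpose_sum]
  exact Finset.sum_congr rfl fun i _ => by rw [transpose_smul, hA i]

theorem trace_dotMat_mul (lam : EuclideanSpace ℝ (Fin m))
    (A : Fin m → Matrix (Fin n) (Fin n) ℝ) (X : Matrix (Fin n) (Fin n) ℝ) :
    (dotMat lam A * X).trace = ∑ i, lam i * (A i * X).trace := by
  simp [dotMat, Finset.sum_mul, trace_sum]

theorem lagrangian_eq_freeEnergy (C : Matrix (Fin n) (Fin n) ℝ)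
    (A : Fin m → Matrix (Fin n) (Fin n) ℝ) (b : EuclideanSpace ℝ (Fin m)) (β : ℝ)
    (X : Matrix (Fin n) (Fin n) ℝ) (lam : EuclideanSpace ℝ (Fin m)) :
    lagrangian C A b β X lam = freeEnergy (C - dotMat lam A) β X + ∑ i, lam i * b i := by
  rw [lagrangian, freeEnergy, sub_mul, trace_sub, trace_dotMat_mul]
  simp_rw [mul_sub, Finset.sum_sub_distrib]
  ring

theorem lagrangian_eq_add (C : Matrix (Fin n) (Fin n) ℝ)
    (A : Fin m → Matrix (Fin n) (Fin n) ℝ) (b : EuclideanSpace ℝ (Fin m)) (β : ℝ)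
    (X : Matrix (Fin n) (Fin n) ℝ) (lam mu : EuclideanSpace ℝ (Fin m)) :
    lagrangian C A b β X mu = lagrangian C A b β X lam -
      ((dotMat (mu - lam) A * X).trace - inner ℝ b (mu - lam)) := by
  rw [lagrangian, lagrangian, trace_dotMat_mul, PiLp.inner_apply, sub_sub, ← Finset.sum_sub_distrib,
    ← Finset.sum_add_distrib]
  congr 1
  refine Finset.sum_congr rfl fun i _ => ?_
  simp
  ring

/-- The gradient of the Lagrangian in the multipliers, up to sign. -/
noncomputable def constraintResidual (A : Fin m → Matrix (Fin n) (Fin n) ℝ)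
    (b : EuclideanSpace ℝ (Fin m)) (X : Matrix (Fin n) (Fin n) ℝ) : EuclideanSpace ℝ (Fin m) :=
  WithLp.toLp 2 (fun i => (A i * X).trace) - b

theorem inner_constraintResidual (A : Fin m → Matrix (Fin n) (Fin n) ℝ)
    (b : EuclideanSpace ℝ (Fin m)) (X : Matrix (Fin n) (Fin n) ℝ) (d : EuclideanSpace ℝ (Fin m)) :
    inner ℝ (constraintResidual A b X) d = (dotMat d A * X).trace - inner ℝ b d := by
  rw [constraintResidual, inner_sub_left, trace_dotMat_mul, PiLp.inner_apply]
  simp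

/-- The negative dual objective is convex and `β`-smooth: at every point it has a gradient for
which its linear model is a lower bound and its quadratic model an upper bound. -/
theorem exists_gradient_negDual [Nonempty (Fin n)] {C : Matrix (Fin n) (Fin n) ℝ} (hC : C.IsSymm)
    {A : Fin m → Matrix (Fin n) (Fin n) ℝ} (hA : ∀ i, (A i).IsSymm)
    (b : EuclideanSpace ℝ (Fin m)) {β : ℝ} (hβ : 0 < β) {N : Seminorm ℝ (EuclideanSpace ℝ (Fin m))}
    (hNA : ∀ x, spectralNorm (dotMat x A) ≤ N x) :
    ∃ Y : EuclideanSpace ℝ (Fin m) → Matrix (Fin n) (Fin n) ℝ,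
      ∀ lam, Y lam ∈ densityMatrices n ∧
      negDual C A b β lam = -lagrangian C A b β (Y lam) lam ∧
      (∀ X ∈ densityMatrices n, -lagrangian C A b β X lam ≤ negDual C A b β lam) ∧
      ∀ mu, negDual C A b β lam + inner ℝ (constraintResidual A b (Y lam)) (mu - lam) ≤
          negDual C A b β mu ∧
        negDual C A b β mu ≤ negDual C A b β lam +
          inner ℝ (constraintResidual A b (Y lam)) (mu - lam) + β / 2 * N (mu - lam) ^ 2 := by
  have hM : ∀ lam, (C - dotMat lam A).IsHermitian := fun lam =>
    IsHermitian.sub (by rw [IsHermitian, conjTranspose_eq_transpose_of_trivial, hC])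
      (dotMat_isHermitian hA lam)
  choose Y hY hmin using fun lam => exists_gibbs_state (hM lam) hβ
  have hle : ∀ lam, ∀ X ∈ densityMatrices n,
      lagrangian C A b β (Y lam) lam ≤ lagrangian C A b β X lam := fun lam X hX => by
    -- The choice $H=0$ leaves plain optimality of the Gibbs state.
    have := hmin lam X hX 0 isHermitian_zero
    simp only [zero_mul, trace_zero, spectralNorm, map_zero, norm_zero] at this
    rw [lagrangian_eq_freeEnergy, lagrangian_eq_freeEnergy]
    linarith
  have hval : ∀ lam, negDual C A b β lam = -lagrangian C A b β (Y lam) lam := fun lam => by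
    rw [negDual, dualObjective]
    congr 1
    refine IsLeast.csInf_eq ⟨⟨Y lam, hY lam, rfl⟩, ?_⟩
    rintro _ ⟨X, hX, rfl⟩
    exact hle lam X hX
  refine ⟨Y, fun lam => ⟨hY lam, hval lam, fun X hX => ?_, fun mu => ⟨?_, ?_⟩⟩⟩
  · rw [hval]; exact neg_le_neg (hle lam X hX)
  · have := hle mu (Y lam) (hY lam)
    rw [lagrangian_eq_add C A b β (Y lam) lam mu] at this
    rw [hval, hval, inner_constraintResidual]
    linarith
  -- Smoothness comes from comparing the two Gibbs states, with the change of cost matrix itself as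
  -- test matrix.
  · have h := hmin lam (Y mu) (hY mu) (dotMat (mu - lam) A) (dotMat_isHermitian hA _)
    have h2 := lagrangian_eq_add C A b β (Y mu) lam mu
    rw [lagrangian_eq_freeEnergy C A b β (Y mu) lam] at h2
    have h3 : spectralNorm (dotMat (mu - lam) A) ^ 2 ≤ N (mu - lam) ^ 2 :=
      pow_le_pow_left₀ (norm_nonneg _) (hNA _) 2
    have h4 := mul_le_mul_of_nonneg_left h3 (by positivity : 0 ≤ β / 2)
    rw [hval, hval, inner_constraintResidual, h2, lagrangian_eq_freeEnergy C A b β (Y lam) lam]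
    linarith

/-- The sandwich makes the linearization error $O(\|y-x\|^2)$, since `N` is dominated by the
Euclidean norm. -/
theorem hasGradientAt_of_quadratic_bounds {f : EuclideanSpace ℝ (Fin m) → ℝ} {β : ℝ} (hβ : 0 < β)
    (N : Seminorm ℝ (EuclideanSpace ℝ (Fin m))) {x G : EuclideanSpace ℝ (Fin m)}
    (h : ∀ y, f x + inner ℝ G (y - x) ≤ f y ∧
      f y ≤ f x + inner ℝ G (y - x) + β / 2 * N (y - x) ^ 2) : HasGradientAt f G x := by
  obtain ⟨K, hK, hN⟩ := N.bound_of_continuous_normedSpace (seminorm_continuous N)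
  have hO : (fun y => f y - f x - inner ℝ G (y - x)) =O[nhds x] fun y => ‖y - x‖ ^ 2 := by
    refine Asymptotics.IsBigO.of_bound (β / 2 * K ^ 2) (Filter.Eventually.of_forall fun y => ?_)
    have h1 := pow_le_pow_left₀ (apply_nonneg N _) (hN (y - x)) 2
    have h2 := mul_le_mul_of_nonneg_left h1 (by positivity : 0 ≤ β / 2)
    rw [Real.norm_of_nonneg (by linarith [(h y).1]), Real.norm_of_nonneg (by positivity)]
    linarith [(h y).2, mul_pow K ‖y - x‖ 2]
  rw [hasGradientAt_iff_isLittleO]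
  exact hO.trans_isLittleO ((Asymptotics.isLittleO_pow_sub_sub x one_lt_two))

/-- Feasibility of `X` kills the constraint term for every multiplier, and the zero multiplier kills
it for every `Y`; hence a bound independent of `lam`. -/
theorem lagrangian_sub_lagrangian_zero_le [Nonempty (Fin n)] {C : Matrix (Fin n) (Fin n) ℝ} (hC : C.IsSymm)
    {A : Fin m → Matrix (Fin n) (Fin n) ℝ} {b : EuclideanSpace ℝ (Fin m)} {β : ℝ} (hβ : 0 < β)
    {X Y : Matrix (Fin n) (Fin n) ℝ} (hX : X ∈ densityMatrices n) (hY : Y ∈ densityMatrices n)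
    (hXb : ∀ i, (A i * X).trace = b i) (lam : EuclideanSpace ℝ (Fin m)) :
    lagrangian C A b β X lam - lagrangian C A b β Y 0 ≤ deltaE C + β⁻¹ * Real.log n := by
  have hC' : C.IsHermitian := by rw [IsHermitian, conjTranspose_eq_transpose_of_trivial, hC]
  have h1 : β⁻¹ * entropy X ≤ β⁻¹ * 0 :=
    mul_le_mul_of_nonneg_left (entropy_nonpos hX) (inv_pos.2 hβ).le
  have h2 := mul_le_mul_of_nonneg_left (neg_log_le_entropy hY) (inv_pos.2 hβ).le
  simp only [lagrangian, hXb, sub_self, mul_zero, Finset.sum_const_zero, PiLp.zero_apply, zero_mul]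
  rw [deltaE]
  linarith [(trace_mul_mem_Icc hC' hX).2, (trace_mul_mem_Icc hC' hY).1]

end EntropicSDP

theorem theorem1 {n m : ℕ}
    (C : Matrix (Fin n) (Fin n) ℝ) (hC : C.IsSymm)
    (A : Fin m → Matrix (Fin n) (Fin n) ℝ) (hA : ∀ i, (A i).IsSymm)
    (b : EuclideanSpace ℝ (Fin m)) (hfeas : EntropicSDP.Feasible A b)
    (β : ℝ) (hβ : 0 < β)
    (N : Seminorm ℝ (EuclideanSpace ℝ (Fin m))) (hN : ∀ x, N x = 0 → x = 0)
    (hNA : ∀ x, EntropicSDP.spectralNorm (EntropicSDP.dotMat x A) ≤ N x)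
    (γ : ℝ) (hγ : 0 ≤ γ) (T : ℕ) (hT : 1 ≤ T)
    (g lam : ℕ → EuclideanSpace ℝ (Fin m))
    (hlam : EntropicSDP.IsGradientDescent N (EntropicSDP.negDual C A b β) (1 / β) T g lam)
    (hg : ∀ t < T,
      EntropicSDP.dualNorm N (g t - gradient (EntropicSDP.negDual C A b β) (lam t)) ≤ γ) :
    Differentiable ℝ (EntropicSDP.negDual C A b β) ∧
    ∃ t < T,
      EntropicSDP.dualNorm N (gradient (EntropicSDP.negDual C A b β) (lam t)) ≤
        3 * γ + 2 * Real.sqrt (β * EntropicSDP.deltaE C / T) +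
          2 * Real.sqrt (Real.log n / T) := by
  obtain ⟨X, hX, hXb⟩ := hfeas
  -- For `n = 0` every trace is zero, so no density matrix exists.
  have hn : Nonempty (Fin n) := by
    by_contra h
    rw [not_nonempty_iff] at h
    have := hX.2
    simp [Matrix.trace] at this
  obtain ⟨Y, hY⟩ := EntropicSDP.exists_gradient_negDual hC hA b hβ hNA
  have hgrad : ∀ x, HasGradientAt (EntropicSDP.negDual C A b β)
      (EntropicSDP.constraintResidual A b (Y x)) x := fun x =>
    EntropicSDP.hasGradientAt_of_quadratic_bounds hβ N (hY x).2.2.2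
  refine ⟨fun x => (hgrad x).differentiableAt, ?_⟩
  have hT0 : (0 : ℝ) < T := by exact_mod_cast hT
  have hE : 0 ≤ β * EntropicSDP.deltaE C / T := by
    have hC' : C.IsHermitian := by
      rw [Matrix.IsHermitian, Matrix.conjTranspose_eq_transpose_of_trivial, hC]
    have h := EntropicSDP.trace_mul_mem_Icc hC' hX
    have : 0 ≤ EntropicSDP.deltaE C := sub_nonneg.2 (h.1.trans h.2)
    positivity
  have hL : 0 ≤ Real.log n / T := div_nonneg (Real.log_natCast_nonneg n) hT0.le
  simp_rw [add_assoc]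
  refine EntropicSDP.exists_dualNorm_gradient_le hN hβ (fun x y => ?_) hγ hT hlam hg
    (by positivity) ?_
  · rw [(hgrad x).gradient]
    exact ((hY x).2.2.2 y).2
  · have h1 := EntropicSDP.lagrangian_sub_lagrangian_zero_le hC hβ hX (hY 0).1 hXb (lam T)
    have h2 := (hY (lam T)).2.2.1 X hX
    have h3 : EntropicSDP.negDual C A b β 0 - EntropicSDP.negDual C A b β (lam T) ≤
        EntropicSDP.deltaE C + β⁻¹ * Real.log n := by
      rw [(hY 0).2.1]; linarith
    have h4 := mul_le_mul_of_nonneg_left h3 (by positivity : 0 ≤ 2 * β)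
    have s1 := Real.sq_sqrt hE
    have s2 := Real.sq_sqrt hL
    have s3 := mul_nonneg (Real.sqrt_nonneg (β * EntropicSDP.deltaE C / T))
      (Real.sqrt_nonneg (Real.log n / T))
    -- The squares of the two root terms alone give twice the required gap; the cross term is
    -- nonnegative and dropped.
    have h5 : T * (4 * (β * EntropicSDP.deltaE C / T + Real.log n / T)) =
        2 * (2 * β * (EntropicSDP.deltaE C + β⁻¹ * Real.log n)) := by
      field_simp
      ring
    have h6 : (0 : ℝ) ≤ T * (4 * (β * EntropicSDP.deltaE C / T + Real.log n / T)) := by positivity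
    have h7 : T * (4 * (β * EntropicSDP.deltaE C / T + Real.log n / T)) ≤
        T * (2 * Real.sqrt (β * EntropicSDP.deltaE C / T) +
          2 * Real.sqrt (Real.log n / T)) ^ 2 :=
      mul_le_mul_of_nonneg_left (by nlinarith) hT0.le
    linarith
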